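/- Let $\mathcal X$ be a feature space and $\mathcal Y=\{-1,+1\}$. A manipulation graph $G$ is a directed graph on $\mathcal X$; write $N_G[x]=\{x\}\cup\{x' : (x,x')\text{ is an edge}\}$. For a classifier $h:\mathcal X\to\mathcal Y$ put $\mathrm{BR}_{G,h}(x)=\{x'\in N_G[x] : h(x')=+1\}$. An agent $(x,y)\in\mathcal X\times\mathcal Y$ facing $h$ reports the feature vector $z=z(h,x)$, where $z=x$ if $\mathrm{BR}_{G,h}(x)=\emptyset$ or $x\in\mathrm{BR}_{G,h}(x)$, and otherwise $z\in\mathrm{BR}_{G,h}(x)$ is chosen by a fixed tie-breaking rule. The strategic loss is $\ell_G^{\mathrm{str}}(h,(x,y))=\mathbf 1\{h(z(h,x))\neq y\}$. In each round $t=1,\dots,T$, a learner selects a distribution $\mathcal D_t$ on classifiers, as a function of its past observations $(h_s,z_s,y_s)_{s<t}$ (post-manipulation feedback); simultaneously an adaptive adversary, who knows the learner's algorithm, selects an agent $(x_t,y_t)$, possibly at random, depending on the whole past $(h_s,x_s,y_s)_{s<t}$. Then $h_t\sim\mathcal D_t$ is sampled, independently of $(x_t,y_t)$ given the past, and the learner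 observes $z_t=z(h_t,x_t)$ and $y_t$. The learner is proper for a class $\mathcal H$ if $\mathcal D_t$ is always supported on $\mathcal H$. The expected Stackelberg regret is \[ \mathbb E[\mathfrak R_T]=\max_{h\in\mathcal H}\sum_{t=1}^T\mathbb E\left[\ell_G^{\mathrm{str}}(h_t,(x_t,y_t))-\ell_G^{\mathrm{str}}(h,(x_t,y_t))\right]. \] There is a universal constant $C>0$ such that for every manipulation graph $G$, every finite non-empty class $\mathcal H\subseteq\mathcal Y^{\mathcal X}$ of size $n$ and every $T\ge 1$, there is a proper randomized learner (which may depend on $G$, $\mathcal H$ and $T$) that guarantees, for every tie-breaking rule and against every adaptive adversary, \[ \mathbb E[\mathfrak R_T]\le C\,\min\left\{\sqrt{T\log n}+n\log(nT),\ \sqrt{T\,n\log n}\right\}. \] -/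

import Mathlib

namespace StrategicOnline

/-- The label space `{-1, +1}`. -/
abbrev Label : Type := ℤˣ

/-- An agent `(x, y)`: a feature vector and its true label. -/
abbrev Agent (X : Type*) : Type _ := X × Label

/-- The closed neighbourhood `N_G[x] = {x} ∪ {x' | (x, x') is an edge}` in the (directed)
manipulation graph `G`; undirected graphs are the symmetric ones. -/
def closedNbhd {X : Type*} (G : Digraph X) (x : X) : Set X :=
  {x' | x' = x ∨ G.Adj x x'}

/-- The set of best responses of `x` under the classifier `h`. -/
def bestResponses {X : Type*} (G : Digraph X) (h : X → Label) (x : X) : Set X :=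
  {x' | x' ∈ closedNbhd G x ∧ h x' = 1}

/-- `z h x` is the manipulated feature vector of an agent at `x` facing `h`: the agent stays if it
has no best response or is itself a best response, and otherwise moves to a best response. Such a
function `z` is a fixed tie-breaking rule. -/
def IsManipulationRule {X : Type*} (G : Digraph X) (z : (X → Label) → X → X) : Prop :=
  ∀ (h : X → Label) (x : X),
    ((bestResponses G h x = ∅ ∨ x ∈ bestResponses G h x) → z h x = x) ∧
    (¬ (bestResponses G h x = ∅ ∨ x ∈ bestResponses G h x) → z h x ∈ bestResponses G h x)

/-- The strategic loss `1{h(z) ≠ y}` of `h` at the agent `(x, y)`, where `z` is the manipulated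
feature vector. -/
def strategicLoss {X : Type*} (z : (X → Label) → X → X) (h : X → Label) (a : Agent X) : ℝ :=
  if h (z h a.1) ≠ a.2 then 1 else 0

/-- What happens in one round: the classifier sampled by the learner and the agent. -/
structure Round (X : Type*) where
  classifier : X → Label
  agent : Agent X

/-- What the learner sees of one round: its own sampled classifier, the manipulated feature vector
and the true label. -/
structure Observation (X : Type*) where
  classifier : X → Label
  feature : X
  label : Label

/-- Post-manipulation feedback. -/
def Round.observe {X : Type*} (z : (X → Label) → X → X) (r : Round X) : Observation X where
  classifier := r.classifier
  feature := z r.classifier r.agent.1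
  label := r.agent.2

/-- A randomized learner: from the observations of the past rounds (most recent first) it computes
the distribution from which the next classifier is sampled. -/
abbrev Learner (X : Type*) : Type _ := List (Observation X) → PMF (X → Label)

/-- The learner only ever plays classifiers of the class `H`. -/
def Learner.IsProper {X : Type*} (L : Learner X) (H : Finset (X → Label)) : Prop :=
  ∀ o : List (Observation X), (L o).support ⊆ (H : Set (X → Label))

/-- An adaptive adversary, possibly randomized: from the complete past (most recent round first) it
computes the distribution of the next agent. It does not see the classifier sampled in the current
round. (As it may depend on the learner, it may use the learner's current distribution, which is a
function of the past; deterministic adversaries are those with values `PMF.pure _`.) -/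
abbrev Adversary (X : Type*) : Type _ := List (Round X) → PMF (Agent X)

/-- The law of the next round after the past `past`: the agent and the classifier are chosen
simultaneously, i.e. independently given the past. -/
noncomputable def nextRound {X : Type*} (z : (X → Label) → X → X) (L : Learner X)
    (A : Adversary X) (past : List (Round X)) : PMF (Round X) :=
  (A past).bind fun a => (L (past.map (Round.observe z))).map fun h => ⟨h, a⟩

/-- The law of the first `t` rounds, listed with the most recent round first. -/
noncomputable def historyLaw {X : Type*} (z : (X → Label) → X → X) (L : Learner X)
    (A : Adversary X) : ℕ → PMF (List (Round X))
  | 0 => PMF.pure []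
  | t + 1 => (historyLaw z L A t).bind fun past =>
      (nextRound z L A past).map fun r => r :: past

/-- The law of the round that is played after `t` earlier rounds. -/
noncomputable def roundLaw {X : Type*} (z : (X → Label) → X → X) (L : Learner X)
    (A : Adversary X) (t : ℕ) : PMF (Round X) :=
  (historyLaw z L A t).bind (nextRound z L A)

/-- The expectation of a real function under a discrete distribution. -/
noncomputable def expectation {α : Type*} (p : PMF α) (f : α → ℝ) : ℝ :=
  ∑' a, (p a).toReal * f a

/-- The series defining the expectation of a bounded function converges. -/
theorem summable_expectation {α : Type*} (p : PMF α) (f : α → ℝ) (B : ℝ)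
    (hf : ∀ a, |f a| ≤ B) : Summable fun a => (p a).toReal * f a := by
  have hp : Summable fun a => (p a).toReal := ENNReal.summable_toReal p.tsum_coe_ne_top
  refine Summable.of_norm_bounded (hp.mul_right B) fun a => ?_
  rw [Real.norm_eq_abs, abs_mul, abs_of_nonneg ENNReal.toReal_nonneg]
  exact mul_le_mul_of_nonneg_left (hf a) ENNReal.toReal_nonneg

/-- The expected Stackelberg regret over `T` rounds,
`max_{h ∈ H} ∑_t E[ℓ(h_t, (x_t, y_t)) - ℓ(h, (x_t, y_t))]`. -/
noncomputable def expectedRegret {X : Type*} (z : (X → Label) → X → X) (H : Finset (X → Label))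
    (hH : H.Nonempty) (L : Learner X) (A : Adversary X) (T : ℕ) : ℝ :=
  H.sup' hH fun h => ∑ t ∈ Finset.range T,
    expectation (roundLaw z L A t) fun r =>
      strategicLoss z r.classifier r.agent - strategicLoss z h r.agent

end StrategicOnline

/-! The loss of a classifier depends only on whether it rejects the agent `(x, y)`, i.e. whether `x`
has no best response, and whenever the sampled classifier rejects, the reported feature is `x`
itself. So the learner faces a bandit problem in which drawing any rejecting classifier reveals the
losses of all of them; importance weighting by the probability `q` of a rejection gives an unbiased
estimate with second moment `∑ i ∈ S, p i / q ≤ 1`, free of any dependence on the number of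
classifiers. Mirror descent with the entropy alone needs all estimates to be at most `1 / η`, which
costs a uniform exploration of rate `η` per classifier and gives the bound `√(T n log n)`. Adding a
logarithmic barrier to the entropy keeps the update stable for arbitrarily large estimates, at the
price `n log (n T)`. -/

namespace StrategicOnline

open Finset Real

/-! ### Divergences -/

/-- The Bregman divergence of `x ↦ x * log x` on `(0, ∞)`, the coordinate of the relative entropy
of nonnegative vectors. -/
noncomputable def entropyDiv (x y : ℝ) : ℝ :=
  x * log (x / y) - x + y

/-- The Bregman divergence of the logarithmic barrier `x ↦ -log x` on `(0, ∞)`. -/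
noncomputable def barrierDiv (x y : ℝ) : ℝ :=
  x / y - 1 - log (x / y)

/-- The Bregman divergence of the hybrid regularizer `x ↦ x * log x / η - c * log x` on `(0, ∞)`,
where `η` is the learning rate and `c` the weight of the logarithmic barrier. -/
noncomputable def hybridDiv (η c x y : ℝ) : ℝ :=
  entropyDiv x y / η + c * barrierDiv x y

section ScalarDivergence

variable {η c g p q u w x y : ℝ}

theorem mul_sub_entropyDiv_le (hx : 0 < x) (hy : 0 < y) (w : ℝ) :
    x * w - entropyDiv x y ≤ y * (exp w - 1) := by
  have hlog := log_le_sub_one_of_pos (show 0 < y * exp w / x by positivity)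
  rw [log_div (by positivity) hx.ne', log_mul hy.ne' (exp_pos w).ne', log_exp] at hlog
  have hmul := mul_le_mul_of_nonneg_left hlog hx.le
  have hcancel : x * (y * exp w / x - 1) = y * exp w - x := by field_simp
  rw [entropyDiv, log_div hx.ne' hy.ne']
  linarith

theorem entropyDiv_nonneg (hx : 0 < x) (hy : 0 < y) : 0 ≤ entropyDiv x y := by
  simpa using mul_sub_entropyDiv_le hx hy 0

theorem barrierDiv_nonneg (hx : 0 < x) (hy : 0 < y) : 0 ≤ barrierDiv x y :=
  sub_nonneg.2 (log_le_sub_one_of_pos (div_pos hx hy))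

theorem hybridDiv_nonneg (hη : 0 ≤ η) (hc : 0 ≤ c) (hx : 0 < x) (hy : 0 < y) :
    0 ≤ hybridDiv η c x y :=
  add_nonneg (div_nonneg (entropyDiv_nonneg hx hy) hη) (mul_nonneg hc (barrierDiv_nonneg hx hy))

theorem hybridDiv_three_point (hu : 0 < u) (hp : 0 < p) (hq : 0 < q) :
    (log (q / p) / η + c * (1 / p - 1 / q)) * (u - q) =
      hybridDiv η c u p - hybridDiv η c u q - hybridDiv η c q p := by
  have hbarrier : (1 / p - 1 / q) * (u - q) = u / p - u / q - q / p + 1 := by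
    field_simp
    ring
  rw [add_mul, mul_assoc c, hbarrier]
  unfold hybridDiv entropyDiv barrierDiv
  rw [log_div hu.ne' hp.ne', log_div hu.ne' hq.ne', log_div hq.ne' hp.ne']
  ring

theorem hasDerivAt_hybridDiv (hp : p ≠ 0) (hq : q ≠ 0) :
    HasDerivAt (fun x => hybridDiv η c x p) (log (q / p) / η + c * (1 / p - 1 / q)) q := by
  have hdiv : HasDerivAt (fun x : ℝ => x / p) (1 / p) q := (hasDerivAt_id q).div_const p
  have hlog : HasDerivAt (fun x : ℝ => log (x / p)) (1 / q) q :=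
    (hdiv.log (div_ne_zero hq hp)).congr_deriv (by field_simp)
  have hentropy : HasDerivAt (fun x => entropyDiv x p) (log (q / p)) q :=
    ((((hasDerivAt_id q).mul hlog).sub (hasDerivAt_id q)).add_const p).congr_deriv
      (by simp only [id]; field_simp; ring)
  exact (hentropy.div_const η).add (((hdiv.sub_const 1).sub hlog).const_mul c)

theorem exp_le_one_add_add_sq (hw : w ≤ 1) : exp w ≤ 1 + w + w ^ 2 := by
  rcases le_or_gt (-1) w with h | h
  · linarith [(abs_le.1 (abs_exp_sub_one_sub_id_le (abs_le.2 ⟨h, hw⟩))).2]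
  · nlinarith [exp_le_one_iff.2 (by linarith : w ≤ 0)]

theorem mul_sub_sub_entropyDiv_div_le (hη : 0 < η) (hx : 0 < x) (hy : 0 < y) (hg : η * g ≤ 1) :
    g * (x - y) - entropyDiv x y / η ≤ η * (y * g ^ 2) := by
  have hconj := mul_sub_entropyDiv_le hx hy (η * g)
  have hexp := mul_le_mul_of_nonneg_left (exp_le_one_add_add_sq hg) hy.le
  rw [sub_le_comm, le_div_iff₀ hη]
  linarith

theorem two_mul_log_le (hx : 0 < x) : 2 * log x ≤ x := by
  rcases le_or_gt (log x) 0 with h | h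
  · linarith
  · calc 2 * log x ≤ exp 1 * log x := by gcongr; linarith [add_one_le_exp (1 : ℝ)]
      _ ≤ exp (log x) := exp_one_mul_le_exp
      _ = x := exp_log hx

theorem mul_sub_two_mul_barrierDiv_le (hx : 0 < x) (hy : 0 < y) (hg : 0 ≤ g) (hyg : y * g ≤ 1) :
    g * (x - y) - 2 * barrierDiv x y ≤ y * g := by
  have hnonneg := barrierDiv_nonneg hx hy
  have hlog := two_mul_log_le (div_pos hx hy)
  have hscale : g * (x - y) = y * g * (x / y - 1) := by field_simp
  have hyg0 : 0 ≤ y * g := by positivity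
  -- The difference is affine in `y * g ∈ [0, 1]`, so it suffices to compare at the end points.
  suffices y * g * (x / y - 2) ≤ 2 * barrierDiv x y by linarith
  rcases le_or_gt (x / y) 2 with h | h
  · nlinarith
  · have hend : x / y - 2 ≤ 2 * barrierDiv x y := by
      unfold barrierDiv
      linarith
    nlinarith

/-- Local stability: the entropy controls gains up to `1 / η`, while for larger gains a barrier of
weight `2` takes over. -/
theorem mul_sub_sub_hybridDiv_le (hη : 0 < η) (hc : 0 ≤ c) (hx : 0 < x) (hy : 0 < y)
    (hyg : y * g ≤ 1) (hstable : 2 ≤ c ∨ η * g ≤ 1) :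
    g * (x - y) - hybridDiv η c x y ≤ η * (y * g ^ 2) := by
  have hbarrier := barrierDiv_nonneg hx hy
  unfold hybridDiv
  rcases le_or_gt (η * g) 1 with hsmall | hlarge
  · linarith [mul_sub_sub_entropyDiv_div_le hη hx hy hsmall, mul_nonneg hc hbarrier]
  · have hg : 0 < g := pos_of_mul_pos_right (one_pos.trans hlarge) hη.le
    have hweight := mul_le_mul_of_nonneg_right (hstable.resolve_right hlarge.not_ge) hbarrier
    have hquad : y * g ≤ η * (y * g ^ 2) := by
      nlinarith [mul_le_mul_of_nonneg_left hlarge.le (mul_pos hy hg).le]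
    linarith [mul_sub_two_mul_barrierDiv_le hx hy hg.le hyg,
      div_nonneg (entropyDiv_nonneg hx hy) hη.le]

end ScalarDivergence

/-! ### Mirror descent on the truncated simplex -/

section MirrorDescent

variable {ι : Type*} [Fintype ι] {ε η c : ℝ}

/-- The probability vectors with all coordinates at least `ε`. For `0 < ε` the barrier is bounded on
this set. -/
def truncatedSimplex (ι : Type*) [Fintype ι] (ε : ℝ) : Set (ι → ℝ) :=
  stdSimplex ℝ ι ∩ Set.Ici fun _ => ε

/-- The Bregman divergence of the hybrid regularizer on positive vectors. -/
noncomputable def hybridDivergence (η c : ℝ) (p q : ι → ℝ) : ℝ :=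
  ∑ i, hybridDiv η c (p i) (q i)

theorem convex_truncatedSimplex : Convex ℝ (truncatedSimplex ι ε) :=
  (convex_stdSimplex ℝ ι).inter (convex_Ici _)

theorem isCompact_truncatedSimplex : IsCompact (truncatedSimplex ι ε) :=
  (isCompact_stdSimplex ℝ ι).inter_right isClosed_Ici

theorem pos_of_mem_truncatedSimplex (hε : 0 < ε) {p : ι → ℝ} (hp : p ∈ truncatedSimplex ι ε)
    (i : ι) : 0 < p i :=
  hε.trans_le (hp.2 i)

theorem hybridDivergence_nonneg (hε : 0 < ε) (hη : 0 ≤ η) (hc : 0 ≤ c) {p q : ι → ℝ}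
    (hp : p ∈ truncatedSimplex ι ε) (hq : q ∈ truncatedSimplex ι ε) :
    0 ≤ hybridDivergence η c p q :=
  sum_nonneg fun i _ => hybridDiv_nonneg hη hc (pos_of_mem_truncatedSimplex hε hp i)
    (pos_of_mem_truncatedSimplex hε hq i)

theorem exists_abs_hybridDivergence_le (hε : 0 < ε) (η c : ℝ) {u : ι → ℝ}
    (hu : u ∈ truncatedSimplex ι ε) :
    ∃ B, ∀ p : truncatedSimplex ι ε, |hybridDivergence η c u p| ≤ B := by
  have hcont : ContinuousOn (fun p => hybridDivergence η c u p) (truncatedSimplex ι ε) := by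
    unfold hybridDivergence hybridDiv entropyDiv barrierDiv
    have hne : ∀ p ∈ truncatedSimplex ι ε, ∀ i, p i ≠ 0 := fun p hp i =>
      (pos_of_mem_truncatedSimplex hε hp i).ne'
    have hdiv : ∀ i, ContinuousOn (fun p : ι → ℝ => u i / p i) (truncatedSimplex ι ε) := fun i =>
      continuousOn_const.div (continuous_apply i).continuousOn fun p hp => hne p hp i
    have hlog : ∀ i, ContinuousOn (fun p : ι → ℝ => log (u i / p i)) (truncatedSimplex ι ε) :=
      fun i => (hdiv i).log fun p hp => div_ne_zero (hne u hu i) (hne p hp i)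
    fun_prop
  obtain ⟨B, hB⟩ := isCompact_truncatedSimplex.exists_bound_of_continuousOn hcont
  exact ⟨B, fun p => hB p p.2⟩

/-- The objective that a mirror descent step from `p` with gain vector `g` minimizes. -/
noncomputable def mirrorObjective (η c : ℝ) (p g q : ι → ℝ) : ℝ :=
  ∑ i, (hybridDiv η c (q i) (p i) - g i * q i)

theorem hasFDerivAt_mirrorObjective {p q : ι → ℝ} (hp : ∀ i, p i ≠ 0) (hq : ∀ i, q i ≠ 0)
    (g : ι → ℝ) :
    HasFDerivAt (mirrorObjective η c p g)
      (∑ i, (log (q i / p i) / η + c * (1 / p i - 1 / q i) - g i) •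
        (ContinuousLinearMap.proj (R := ℝ) (φ := fun _ : ι => ℝ) i)) q := by
  refine HasFDerivAt.fun_sum fun i _ => ?_
  have hlinear : HasDerivAt (fun x => g i * x) (g i) (q i) := by
    simpa using (hasDerivAt_id (q i)).const_mul (g i)
  exact ((hasDerivAt_hybridDiv (hp i) (hq i)).sub hlinear).comp_hasFDerivAt q
    (ContinuousLinearMap.proj (R := ℝ) (φ := fun _ : ι => ℝ) i).hasFDerivAt

theorem exists_isMinOn_mirrorObjective (hε : 0 < ε) (η c : ℝ) (p : truncatedSimplex ι ε)
    (g : ι → ℝ) :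
    ∃ q : truncatedSimplex ι ε, IsMinOn (mirrorObjective η c p.1 g) (truncatedSimplex ι ε) q := by
  have hne : ∀ q ∈ truncatedSimplex ι ε, ∀ i, q i ≠ 0 := fun q hq i =>
    (pos_of_mem_truncatedSimplex hε hq i).ne'
  obtain ⟨q, hq, hmin⟩ := isCompact_truncatedSimplex.exists_isMinOn ⟨p.1, p.2⟩ fun q hq =>
    (hasFDerivAt_mirrorObjective (hne p.1 p.2) (hne q hq) g).continuousAt.continuousWithinAt
  exact ⟨⟨q, hq⟩, hmin⟩

/-- A mirror descent step from `p` with gain vector `g`, for the hybrid regularizer: a minimizer of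
`mirrorObjective` on the truncated simplex. -/
noncomputable def mirrorStep (hε : 0 < ε) (η c : ℝ) (p : truncatedSimplex ι ε) (g : ι → ℝ) :
    truncatedSimplex ι ε :=
  (exists_isMinOn_mirrorObjective hε η c p g).choose

theorem isMinOn_mirrorStep (hε : 0 < ε) (η c : ℝ) (p : truncatedSimplex ι ε) (g : ι → ℝ) :
    IsMinOn (mirrorObjective η c p.1 g) (truncatedSimplex ι ε) (mirrorStep hε η c p g).1 :=
  (exists_isMinOn_mirrorObjective hε η c p g).choose_spec

theorem sum_mul_sub_mirrorStep_le (hε : 0 < ε) (p : truncatedSimplex ι ε) (g : ι → ℝ) {u : ι → ℝ}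
    (hu : u ∈ truncatedSimplex ι ε) :
    ∑ i, g i * (u i - (mirrorStep hε η c p g).1 i) ≤
      hybridDivergence η c u p.1 - hybridDivergence η c u (mirrorStep hε η c p g).1 -
        hybridDivergence η c (mirrorStep hε η c p g).1 p.1 := by
  have hmin := isMinOn_mirrorStep hε η c p g
  set p' := mirrorStep hε η c p g
  have hpos : ∀ q ∈ truncatedSimplex ι ε, ∀ i, 0 < q i := fun q hq i =>
    pos_of_mem_truncatedSimplex hε hq i
  have hoptimal := hmin.localize.hasFDerivWithinAt_nonneg
    (hasFDerivAt_mirrorObjective (fun i => (hpos _ p.2 i).ne')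
      (fun i => (hpos _ p'.2 i).ne') g).hasFDerivWithinAt
    (sub_mem_posTangentConeAt_of_segment_subset
      (convex_truncatedSimplex.segment_subset p'.2 hu))
  simp only [_root_.sum_apply, smul_apply, ContinuousLinearMap.proj_apply, Pi.sub_apply,
    smul_eq_mul] at hoptimal
  unfold hybridDivergence
  rw [← sum_sub_distrib, ← sum_sub_distrib, ← sub_nonneg, ← sum_sub_distrib]
  refine hoptimal.trans_eq (sum_congr rfl fun i _ => ?_)
  rw [← hybridDiv_three_point (hpos u hu i) (hpos _ p.2 i) (hpos _ p'.2 i), ← sub_mul]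

theorem sum_mul_sub_le_of_mirrorStep (hε : 0 < ε) (hη : 0 < η) (hc : 0 ≤ c)
    (p : truncatedSimplex ι ε) {g : ι → ℝ} (hg : ∀ i, p.1 i * g i ≤ 1)
    (hstable : ∀ i, 2 ≤ c ∨ η * g i ≤ 1) {u : ι → ℝ} (hu : u ∈ truncatedSimplex ι ε) :
    ∑ i, g i * (u i - p.1 i) ≤
      hybridDivergence η c u p.1 - hybridDivergence η c u (mirrorStep hε η c p g).1 +
        η * ∑ i, p.1 i * g i ^ 2 := by
  set p' := mirrorStep hε η c p g
  have hlocal : ∑ i, g i * (p'.1 i - p.1 i) - hybridDivergence η c p'.1 p.1 ≤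
      η * ∑ i, p.1 i * g i ^ 2 := by
    unfold hybridDivergence
    rw [← sum_sub_distrib, mul_sum]
    exact sum_le_sum fun i _ => mul_sub_sub_hybridDiv_le hη hc
      (pos_of_mem_truncatedSimplex hε p'.2 i) (pos_of_mem_truncatedSimplex hε p.2 i) (hg i)
      (hstable i)
  have hsplit : ∑ i, g i * (u i - p.1 i) =
      ∑ i, g i * (u i - p'.1 i) + ∑ i, g i * (p'.1 i - p.1 i) := by
    rw [← sum_add_distrib]
    exact sum_congr rfl fun i _ => by ring
  linarith [sum_mul_sub_mirrorStep_le (η := η) (c := c) hε p g hu]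

theorem barycenter_mem_truncatedSimplex [Nonempty ι] (hn : Fintype.card ι * ε ≤ 1) :
    (stdSimplex.barycenter : stdSimplex ℝ ι).1 ∈ truncatedSimplex ι ε := by
  have hpos : (0 : ℝ) < Fintype.card ι := Nat.cast_pos.2 Fintype.card_pos
  refine ⟨stdSimplex.barycenter.2, fun i => ?_⟩
  rw [stdSimplex.barycenter_apply, ← one_div, le_div_iff₀' hpos]
  exact hn

theorem sum_entropyDiv_barycenter_le [Nonempty ι] {u : ι → ℝ} (hu : u ∈ stdSimplex ℝ ι)
    (hu0 : ∀ i, 0 < u i) :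
    ∑ i, entropyDiv (u i) ((stdSimplex.barycenter : stdSimplex ℝ ι).1 i) ≤
      log (Fintype.card ι) := by
  have hn : (Fintype.card ι : ℝ) ≠ 0 := by exact_mod_cast Fintype.card_ne_zero
  have hcoord : ∀ i, entropyDiv (u i) ((stdSimplex.barycenter : stdSimplex ℝ ι).1 i) ≤
      u i * log (Fintype.card ι) - u i + (Fintype.card ι : ℝ)⁻¹ := fun i => by
    have hlog : log (u i) ≤ 0 := log_nonpos (hu0 i).le (mem_Icc_of_mem_stdSimplex hu i).2
    rw [stdSimplex.barycenter_apply, entropyDiv, div_inv_eq_mul, log_mul (hu0 i).ne' hn]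
    nlinarith [hu0 i]
  refine (sum_le_sum fun i _ => hcoord i).trans_eq ?_
  simp [sum_add_distrib, sum_sub_distrib, ← sum_mul, hu.2, hn]

theorem sum_barrierDiv_barycenter_le [Nonempty ι] (hε : 0 < ε) {u : ι → ℝ}
    (hu : u ∈ truncatedSimplex ι ε) :
    ∑ i, barrierDiv (u i) ((stdSimplex.barycenter : stdSimplex ℝ ι).1 i) ≤
      Fintype.card ι * log (1 / ε) := by
  have hn : (1 : ℝ) ≤ Fintype.card ι := by exact_mod_cast Fintype.card_pos
  have hcoord : ∀ i, barrierDiv (u i) ((stdSimplex.barycenter : stdSimplex ℝ ι).1 i) ≤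
      u i * Fintype.card ι - 1 + log (1 / ε) := fun i => by
    have hui := pos_of_mem_truncatedSimplex hε hu i
    have hlog : log ε ≤ log (u i * Fintype.card ι) :=
      log_le_log hε ((hu.2 i).trans (le_mul_of_one_le_right hui.le hn))
    rw [stdSimplex.barycenter_apply, barrierDiv, div_inv_eq_mul, one_div, log_inv]
    linarith
  refine (sum_le_sum fun i _ => hcoord i).trans_eq ?_
  simp [sum_add_distrib, sum_sub_distrib, ← sum_mul, hu.1.2]

theorem hybridDivergence_barycenter_le [Nonempty ι] (hε : 0 < ε) (hη : 0 ≤ η) (hc : 0 ≤ c)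
    {u : ι → ℝ} (hu : u ∈ truncatedSimplex ι ε) :
    hybridDivergence η c u (stdSimplex.barycenter : stdSimplex ℝ ι).1 ≤
      log (Fintype.card ι) / η + c * (Fintype.card ι * log (1 / ε)) := by
  unfold hybridDivergence hybridDiv
  rw [sum_add_distrib, ← sum_div, ← mul_sum]
  gcongr
  · exact sum_entropyDiv_barycenter_le hu.1 (pos_of_mem_truncatedSimplex hε hu)
  · exact sum_barrierDiv_barycenter_le hε hu

end MirrorDescent

/-! ### Gains revealed by every draw from a set of arms -/

section ImportanceWeighting

variable {ι : Type*} [DecidableEq ι] {ε η c s : ℝ}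

/-- The importance weighted estimate, after drawing an arm of `S`, of the gain vector that is `s` on
`S` and `0` elsewhere, where `p` is the distribution of the draw. The estimate after drawing an arm
outside `S` is `0`. -/
noncomputable def importanceWeightedGain (p : ι → ℝ) (S : Finset ι) (s : ℝ) (i : ι) : ℝ :=
  if i ∈ S then s / ∑ j ∈ S, p j else 0

theorem mul_importanceWeightedGain_le_one {p : ι → ℝ} {S : Finset ι} (hp : ∀ i, 0 ≤ p i)
    (hs : |s| ≤ 1) {i : ι} {r : ℝ} (hr : 0 ≤ r) (hri : r ≤ p i) :
    r * importanceWeightedGain p S s i ≤ 1 := by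
  unfold importanceWeightedGain
  split_ifs with hi
  · have hpi : p i ≤ ∑ j ∈ S, p j := single_le_sum (fun j _ => hp j) hi
    rw [mul_div_assoc']
    refine div_le_one_of_le₀ ?_ (sum_nonneg fun j _ => hp j)
    nlinarith [le_of_abs_le hs]
  · simp

variable [Fintype ι]

theorem sum_importanceWeightedGain_mul {p : ι → ℝ} {S : Finset ι} (hq : ∑ j ∈ S, p j ≠ 0)
    (s : ℝ) (v : ι → ℝ) :
    (∑ j ∈ S, p j) * ∑ i, importanceWeightedGain p S s i * v i = s * ∑ i ∈ S, v i := by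
  simp only [importanceWeightedGain, ite_mul, zero_mul, sum_ite_mem, univ_inter, ← mul_sum]
  field_simp

theorem sum_mul_importanceWeightedGain_sq {p : ι → ℝ} {S : Finset ι} (hq : ∑ j ∈ S, p j ≠ 0)
    (s : ℝ) :
    (∑ j ∈ S, p j) * ∑ i, p i * importanceWeightedGain p S s i ^ 2 = s ^ 2 := by
  simp only [importanceWeightedGain, ite_pow, ne_eq, OfNat.ofNat_ne_zero, not_false_eq_true,
    zero_pow, mul_ite, mul_zero, sum_ite_mem, univ_inter, ← sum_mul]
  field_simp

/-- The vertex `k` of the simplex, moved into the truncated simplex by mixing in the uniform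
distribution: the comparator of mirror descent. -/
noncomputable def truncatedVertex (ε : ℝ) (k : ι) : ι → ℝ :=
  fun i => (if i = k then 1 - Fintype.card ι * ε else 0) + ε

theorem truncatedVertex_mem (hε : 0 ≤ ε) (hn : Fintype.card ι * ε ≤ 1) (k : ι) :
    truncatedVertex ε k ∈ truncatedSimplex ι ε := by
  have hle : ∀ i, ε ≤ truncatedVertex ε k i := fun i => by
    unfold truncatedVertex
    split_ifs <;> linarith
  exact ⟨⟨fun i => hε.trans (hle i), by simp [truncatedVertex, sum_add_distrib]⟩, hle⟩

theorem abs_ite_mem_sub_sum_truncatedVertex_le (hε : 0 ≤ ε) (k : ι) (S : Finset ι) :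
    |(if k ∈ S then 1 else 0) - ∑ i ∈ S, truncatedVertex ε k i| ≤ Fintype.card ι * ε := by
  have hsum : ∑ i ∈ S, truncatedVertex ε k i =
      (if k ∈ S then 1 - Fintype.card ι * ε else 0) + #S * ε := by
    simp [truncatedVertex, sum_add_distrib]
  have hcard : #S * ε ≤ Fintype.card ι * ε :=
    mul_le_mul_of_nonneg_right (by exact_mod_cast card_le_univ S) hε
  have hnonneg : 0 ≤ #S * ε := by positivity
  rw [hsum, abs_le]
  split_ifs <;> constructor <;> linarith

theorem mul_sum_sub_le_of_mirrorStep (hε : 0 < ε) (hη : 0 < η) (hc : 0 ≤ c)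
    (hstable : 2 ≤ c ∨ η ≤ ε) (p : truncatedSimplex ι ε) (S : Finset ι) (hs : |s| ≤ 1)
    {u : ι → ℝ} (hu : u ∈ truncatedSimplex ι ε) :
    s * ∑ i ∈ S, (u i - p.1 i) ≤
      (∑ i ∈ S, p.1 i) * (hybridDivergence η c u p.1 -
        hybridDivergence η c u (mirrorStep hε η c p (importanceWeightedGain p.1 S s)).1) + η := by
  rcases S.eq_empty_or_nonempty with rfl | hS
  · simpa using hη.le
  have hq : 0 < ∑ i ∈ S, p.1 i := sum_pos (fun i _ => pos_of_mem_truncatedSimplex hε p.2 i) hS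
  have hstep := sum_mul_sub_le_of_mirrorStep hε hη hc p (g := importanceWeightedGain p.1 S s)
    (fun i => mul_importanceWeightedGain_le_one p.2.1.1 hs (p.2.1.1 i) le_rfl)
    (fun i => hstable.imp_right fun h =>
      mul_importanceWeightedGain_le_one p.2.1.1 hs hη.le (h.trans (p.2.2 i))) hu
  have hscaled := mul_le_mul_of_nonneg_left hstep hq.le
  rw [sum_importanceWeightedGain_mul hq.ne', mul_add, mul_left_comm _ η,
    sum_mul_importanceWeightedGain_sq hq.ne'] at hscaled
  nlinarith [(sq_le_one_iff_abs_le_one s).2 hs]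

theorem sum_mul_ite_mem {p : ι → ℝ} (hp : ∑ i, p i = 1) (S : Finset ι) (a b : ℝ) :
    ∑ i, p i * (if i ∈ S then a else b) = (∑ i ∈ S, p i) * (a - b) + b := by
  have hsplit : ∀ i, p i * (if i ∈ S then a else b) =
      (if i ∈ S then p i else 0) * (a - b) + p i * b := fun i => by
    split_ifs <;> ring
  simp only [hsplit, sum_add_distrib, ← sum_mul, sum_ite_mem, univ_inter, hp, one_mul]

theorem expected_mirrorStep_le (hε : 0 < ε) (hη : 0 < η) (hc : 0 ≤ c)
    (hstable : 2 ≤ c ∨ η ≤ ε) (hn : Fintype.card ι * ε ≤ 1) (p : truncatedSimplex ι ε)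
    (S : Finset ι) (hs : |s| ≤ 1) (k₀ : ι) :
    ∑ k, p.1 k * ((if k₀ ∈ S then s else 0) - (if k ∈ S then s else 0) +
        hybridDivergence η c (truncatedVertex ε k₀)
          (if k ∈ S then mirrorStep hε η c p (importanceWeightedGain p.1 S s) else p).1) ≤
      hybridDivergence η c (truncatedVertex ε k₀) p.1 + (η + Fintype.card ι * ε) := by
  have hstep := mul_sum_sub_le_of_mirrorStep hε hη hc hstable p S hs
    (truncatedVertex_mem hε.le hn k₀)
  set p' := mirrorStep hε η c p (importanceWeightedGain p.1 S s)
  set D := hybridDivergence η c (truncatedVertex ε k₀)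
  set gain₀ := if k₀ ∈ S then s else 0
  have hcomparator : gain₀ - s * ∑ i ∈ S, truncatedVertex ε k₀ i ≤ Fintype.card ι * ε := by
    have habs := mul_le_mul hs (abs_ite_mem_sub_sum_truncatedVertex_le hε.le k₀ S)
      (abs_nonneg _) zero_le_one
    rw [← abs_mul, mul_sub, mul_ite, mul_one, mul_zero, one_mul] at habs
    exact le_of_abs_le habs
  have hmerge : ∀ k, gain₀ - (if k ∈ S then s else 0) + D (if k ∈ S then p' else p).1 =
      if k ∈ S then gain₀ - s + D p'.1 else gain₀ + D p.1 := fun k => by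
    split_ifs <;> ring
  simp only [hmerge, sum_mul_ite_mem p.2.1.2]
  rw [sum_sub_distrib] at hstep
  linarith

end ImportanceWeighting

/-! ### Expectations and the protocol -/

section Expectation

variable {α β : Type*} {p : PMF α} {f g : α → ℝ} {B C : ℝ}

theorem hasSum_toReal_pmf (p : PMF α) : HasSum (fun a => (p a).toReal) 1 := by
  simpa [← ENNReal.tsum_toReal_eq p.apply_ne_top, p.tsum_coe]
    using (ENNReal.summable_toReal p.tsum_coe_ne_top).hasSum

theorem expectation_pure (a : α) (f : α → ℝ) : expectation (PMF.pure a) f = f a := by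
  classical
  unfold expectation
  rw [tsum_eq_single a fun b hb => by simp [PMF.pure_apply, hb]]
  simp

theorem expectation_const (p : PMF α) (c : ℝ) : expectation p (fun _ => c) = c := by
  unfold expectation
  rw [tsum_mul_right, (hasSum_toReal_pmf p).tsum_eq, one_mul]

theorem expectation_nonneg (hf : ∀ a, 0 ≤ f a) : 0 ≤ expectation p f :=
  tsum_nonneg fun a => mul_nonneg ENNReal.toReal_nonneg (hf a)

theorem expectation_mono (hf : ∀ a, |f a| ≤ B) (hg : ∀ a, |g a| ≤ C) (h : ∀ a, f a ≤ g a) :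
    expectation p f ≤ expectation p g :=
  (summable_expectation p f B hf).tsum_le_tsum
    (fun a => mul_le_mul_of_nonneg_left (h a) ENNReal.toReal_nonneg)
    (summable_expectation p g C hg)

theorem expectation_le_of_forall_le {b : ℝ} (hf : ∀ a, |f a| ≤ B) (h : ∀ a, f a ≤ b) :
    expectation p f ≤ b :=
  (expectation_mono hf (fun _ => le_rfl) h).trans_eq (expectation_const p b)

theorem expectation_add (hf : ∀ a, |f a| ≤ B) (hg : ∀ a, |g a| ≤ C) :
    expectation p (fun a => f a + g a) = expectation p f + expectation p g := by
  unfold expectation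
  simp only [mul_add]
  exact (summable_expectation p f B hf).tsum_add (summable_expectation p g C hg)

theorem expectation_neg (p : PMF α) (f : α → ℝ) :
    expectation p (fun a => -f a) = -expectation p f := by
  simp only [expectation, mul_neg, tsum_neg]

theorem abs_expectation_le (hf : ∀ a, |f a| ≤ B) : |expectation p f| ≤ B :=
  abs_le'.2 ⟨expectation_le_of_forall_le hf fun a => le_of_abs_le (hf a),
    expectation_neg p f ▸ expectation_le_of_forall_le (fun a => (abs_neg (f a)).trans_le (hf a))
      fun a => (neg_le_abs (f a)).trans (hf a)⟩

theorem summable_toReal_mul_toReal (p : PMF α) (f : α → PMF β) :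
    Summable fun x : α × β => (p x.1).toReal * (f x.1 x.2).toReal := by
  have hinner : ∀ a, HasSum (fun b => (p a).toReal * (f a b).toReal) (p a).toReal := fun a => by
    simpa using (hasSum_toReal_pmf (f a)).mul_left (p a).toReal
  refine (summable_prod_of_nonneg fun x =>
    mul_nonneg ENNReal.toReal_nonneg ENNReal.toReal_nonneg).2 ⟨fun a => (hinner a).summable, ?_⟩
  simpa only [(hinner _).tsum_eq] using (hasSum_toReal_pmf p).summable

theorem expectation_bind (p : PMF α) (f : α → PMF β) {g : β → ℝ} (hg : ∀ b, |g b| ≤ B) :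
    expectation (p.bind f) g = expectation p fun a => expectation (f a) g := by
  have hsum : Summable fun x : α × β => (p x.1).toReal * (f x.1 x.2).toReal * g x.2 := by
    refine Summable.of_norm_bounded ((summable_toReal_mul_toReal p f).mul_right B) fun x => ?_
    have hnonneg : 0 ≤ (p x.1).toReal * (f x.1 x.2).toReal := by positivity
    rw [norm_eq_abs, abs_mul, abs_of_nonneg hnonneg]
    exact mul_le_mul_of_nonneg_left (hg _) hnonneg
  unfold expectation
  calc ∑' b, (p.bind f b).toReal * g b
      = ∑' b, ∑' a, (p a).toReal * (f a b).toReal * g b := by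
        refine tsum_congr fun b => ?_
        rw [PMF.bind_apply, ENNReal.tsum_toReal_eq
          fun a => ENNReal.mul_ne_top (p.apply_ne_top a) ((f a).apply_ne_top b), ← tsum_mul_right]
        simp only [ENNReal.toReal_mul]
    _ = ∑' a, ∑' b, (p a).toReal * (f a b).toReal * g b := Summable.tsum_comm hsum
    _ = ∑' a, (p a).toReal * ∑' b, (f a b).toReal * g b := by
        simp only [mul_assoc, tsum_mul_left]

theorem expectation_map (p : PMF α) (f : α → β) {g : β → ℝ} (hg : ∀ b, |g b| ≤ B) :
    expectation (p.map f) g = expectation p fun a => g (f a) := by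
  rw [← PMF.bind_pure_comp, expectation_bind p _ hg]
  simp only [Function.comp, expectation_pure]

/-- The distribution on `ι` whose weights are the coordinates of a point of the standard simplex. -/
noncomputable def simplexPMF {ι : Type*} [Fintype ι] (p : stdSimplex ℝ ι) : PMF ι :=
  PMF.ofFintype (fun i => ENNReal.ofReal (p i)) (by
    rw [← ENNReal.ofReal_sum_of_nonneg fun i _ => stdSimplex.zero_le p i, stdSimplex.sum_eq_one,
      ENNReal.ofReal_one])

theorem expectation_simplexPMF {ι : Type*} [Fintype ι] (p : stdSimplex ℝ ι) (f : ι → ℝ) :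
    expectation (simplexPMF p) f = ∑ i, p i * f i := by
  unfold expectation simplexPMF
  simp only [tsum_fintype, PMF.ofFintype_apply, ENNReal.toReal_ofReal (stdSimplex.zero_le p _)]

end Expectation

section Protocol

variable {X : Type*} {z : (X → Label) → X → X} {L : Learner X} {A : Adversary X}

theorem expectation_nextRound (past : List (Round X)) {f : Round X → ℝ} {B : ℝ}
    (hf : ∀ r, |f r| ≤ B) :
    expectation (nextRound z L A past) f = expectation (A past) fun a =>
      expectation (L (past.map (Round.observe z))) fun h => f ⟨h, a⟩ := by
  unfold nextRound
  rw [expectation_bind _ _ hf]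
  simp only [expectation_map _ _ hf]

theorem expectation_historyLaw_succ (t : ℕ) {f : List (Round X) → ℝ} {B : ℝ}
    (hf : ∀ l, |f l| ≤ B) :
    expectation (historyLaw z L A (t + 1)) f = expectation (historyLaw z L A t) fun past =>
      expectation (nextRound z L A past) fun r => f (r :: past) := by
  rw [historyLaw, expectation_bind _ _ hf]
  simp only [expectation_map _ _ hf]

section Potential

variable {f : Round X → ℝ} {Φ : List (Round X) → ℝ} {B C κ : ℝ}

theorem expectation_roundLaw_add_historyLaw_succ_le (hf : ∀ r, |f r| ≤ B) (hΦ : ∀ l, |Φ l| ≤ C)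
    (hdrift : ∀ past,
      expectation (nextRound z L A past) (fun r => f r + Φ (r :: past)) ≤ Φ past + κ) (t : ℕ) :
    expectation (roundLaw z L A t) f + expectation (historyLaw z L A (t + 1)) Φ ≤
      expectation (historyLaw z L A t) Φ + κ := by
  rw [roundLaw, expectation_bind _ _ hf, expectation_historyLaw_succ t hΦ,
    ← expectation_add (fun _ => abs_expectation_le hf) fun _ => abs_expectation_le fun _ => hΦ _,
    ← expectation_const (historyLaw z L A t) κ, ← expectation_add hΦ fun _ => le_rfl]
  refine expectation_mono (fun l => (abs_add_le _ _).trans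
    (add_le_add (abs_expectation_le hf) (abs_expectation_le fun _ => hΦ _)))
    (fun l => (abs_add_le _ _).trans (add_le_add (hΦ l) le_rfl)) fun past => ?_
  rw [← expectation_add hf fun _ => hΦ _]
  exact hdrift past

theorem sum_expectation_roundLaw_le (hf : ∀ r, |f r| ≤ B) (hΦ : ∀ l, |Φ l| ≤ C)
    (hΦ0 : ∀ l, 0 ≤ Φ l)
    (hdrift : ∀ past,
      expectation (nextRound z L A past) (fun r => f r + Φ (r :: past)) ≤ Φ past + κ) (T : ℕ) :
    ∑ t ∈ range T, expectation (roundLaw z L A t) f ≤ Φ [] + T * κ := by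
  suffices ∑ t ∈ range T, expectation (roundLaw z L A t) f +
      expectation (historyLaw z L A T) Φ ≤ Φ [] + T * κ by
    linarith [expectation_nonneg (p := historyLaw z L A T) hΦ0]
  induction T with
  | zero => simp [historyLaw, expectation_pure]
  | succ t ih =>
    rw [sum_range_succ]
    push_cast
    linarith [expectation_roundLaw_add_historyLaw_succ_le hf hΦ hdrift t]

end Potential

theorem abs_strategicLoss_sub_le (h h' : X → Label) (a : Agent X) :
    |strategicLoss z h a - strategicLoss z h' a| ≤ 1 := by
  unfold strategicLoss
  split_ifs <;> simp

theorem expectedRegret_le (H : Finset (X → Label)) (hH : H.Nonempty) (T : ℕ) :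
    expectedRegret z H hH L A T ≤ T := by
  refine sup'_le _ _ fun h _ => (sum_le_card_nsmul _ _ 1 fun t _ => ?_).trans_eq (by simp)
  exact le_of_abs_le (abs_expectation_le fun r => abs_strategicLoss_sub_le _ _ _)

theorem expectedRegret_singleton (h : X → Label) (T : ℕ) :
    expectedRegret z {h} (singleton_nonempty h) (fun _ => PMF.pure h) A T = 0 := by
  have hbound : ∀ r : Round X,
      |strategicLoss z r.classifier r.agent - strategicLoss z h r.agent| ≤ 1 :=
    fun r => abs_strategicLoss_sub_le _ _ _
  simp only [expectedRegret, sup'_singleton, roundLaw, expectation_bind _ _ hbound,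
    expectation_nextRound _ hbound, expectation_pure, sub_self, expectation_const, sum_const_zero]

variable {G : Digraph X} {H : Finset (X → Label)} {hH : H.Nonempty} {T : ℕ} {R R' : ℝ}

/-- The learner `L` has expected regret at most `R` after `T` rounds, for every tie-breaking rule
and against every adaptive adversary. -/
def Learner.GuaranteesRegret (L : Learner X) (G : Digraph X) (hH : H.Nonempty) (T : ℕ) (R : ℝ) :
    Prop :=
  ∀ z, IsManipulationRule G z → ∀ A : Adversary X, expectedRegret z H hH L A T ≤ R

theorem Learner.GuaranteesRegret.mono (hL : L.GuaranteesRegret G hH T R) (hR : R ≤ R') :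
    L.GuaranteesRegret G hH T R' :=
  fun z hz A => (hL z hz A).trans hR

theorem exists_learner_guaranteesRegret_horizon (G : Digraph X) (hH : H.Nonempty) (T : ℕ) :
    ∃ L : Learner X, L.IsProper H ∧ L.GuaranteesRegret G hH T T := by
  obtain ⟨h, hh⟩ := id hH
  exact ⟨fun _ => PMF.pure h, fun _ => by simpa using hh, fun _ _ _ => expectedRegret_le H hH T⟩

theorem exists_learner_guaranteesRegret_zero (G : Digraph X) (hH : H.Nonempty) (hcard : #H = 1)
    (T : ℕ) : ∃ L : Learner X, L.IsProper H ∧ L.GuaranteesRegret G hH T 0 := by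
  obtain ⟨h, rfl⟩ := card_eq_one.1 hcard
  exact ⟨fun _ => PMF.pure h, fun _ => by simp, fun _ _ _ => (expectedRegret_singleton h T).le⟩

end Protocol

/-! ### The hybrid mirror descent learner -/

section HybridLearner

variable {X : Type*} {G : Digraph X} {z : (X → Label) → X → X} {H : Finset (X → Label)}

open Classical in
/-- The classifiers of `H` that label an agent at `x` negatively after its manipulation, whatever
the tie-breaking rule. -/
noncomputable def rejectors (G : Digraph X) (H : Finset (X → Label)) (x : X) : Finset H :=
  {h | bestResponses G h x = ∅}

theorem IsManipulationRule.apply_eq_one_iff (hz : IsManipulationRule G z) (h : X → Label) (x : X) :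
    h (z h x) = 1 ↔ (bestResponses G h x).Nonempty := by
  by_cases hstay : bestResponses G h x = ∅ ∨ x ∈ bestResponses G h x
  · rw [(hz h x).1 hstay]
    exact ⟨fun hx => ⟨x, Or.inl rfl, hx⟩, fun hne => (hstay.resolve_left hne.ne_empty).2⟩
  · have hmove := (hz h x).2 hstay
    exact ⟨fun _ => ⟨_, hmove⟩, fun _ => hmove.2⟩

theorem IsManipulationRule.mem_rejectors_iff (hz : IsManipulationRule G z) (h : H) (x : X) :
    h ∈ rejectors G H x ↔ h.1 (z h.1 x) ≠ 1 := by
  rw [Ne, hz.apply_eq_one_iff, Set.not_nonempty_iff_eq_empty, rejectors, mem_filter_univ]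

theorem IsManipulationRule.apply_eq_self_of_mem_rejectors (hz : IsManipulationRule G z) {h : H}
    {x : X} (hh : h ∈ rejectors G H x) : z h.1 x = x :=
  (hz h.1 x).1 (Or.inl ((mem_filter_univ h).1 hh))

variable [DecidableEq (X → Label)]

theorem IsManipulationRule.strategicLoss_eq (hz : IsManipulationRule G z) (h : H) (a : Agent X) :
    strategicLoss z h.1 a =
      (1 - (a.2 : ℤ)) / 2 - if h ∈ rejectors G H a.1 then -((a.2 : ℤ) : ℝ) else 0 := by
  simp only [strategicLoss, hz.mem_rejectors_iff]
  rcases Int.units_eq_one_or a.2 with hy | hy <;>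
    rcases Int.units_eq_one_or (h.1 (z h.1 a.1)) with hh | hh <;> rw [hy, hh] <;> norm_num

variable {ε : ℝ}

/-- The weights of the hybrid mirror descent learner, starting from `p₀`. A round is used only if
the sampled classifier rejected the agent, for then the reported feature is the true one; the gain
of every rejecting classifier is the negated label. -/
noncomputable def hybridWeights (G : Digraph X) (hε : 0 < ε) (η c : ℝ)
    (p₀ : truncatedSimplex H ε) : List (Observation X) → truncatedSimplex H ε
  | [] => p₀
  | o :: l =>
    if o.classifier o.feature = 1 then hybridWeights G hε η c p₀ l
    else mirrorStep hε η c (hybridWeights G hε η c p₀ l)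
      (importanceWeightedGain (hybridWeights G hε η c p₀ l).1 (rejectors G H o.feature)
        (-((o.label : ℤ) : ℝ)))

/-- The proper learner that samples from `hybridWeights`. -/
noncomputable def hybridLearner (G : Digraph X) (hε : 0 < ε) (η c : ℝ)
    (p₀ : truncatedSimplex H ε) : Learner X :=
  fun o => (simplexPMF (Set.inclusion Set.inter_subset_left
    (hybridWeights G hε η c p₀ o))).map Subtype.val

/-- The potential of the regret analysis: the divergence of the learner's weights from the
comparator `u`. -/
noncomputable def hybridPotential (z : (X → Label) → X → X) (G : Digraph X) (hε : 0 < ε) (η c : ℝ)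
    (p₀ : truncatedSimplex H ε) (u : H → ℝ) (past : List (Round X)) : ℝ :=
  hybridDivergence η c u (hybridWeights G hε η c p₀ (past.map (Round.observe z))).1

theorem hybridLearner_isProper (G : Digraph X) (hε : 0 < ε) (η c : ℝ)
    (p₀ : truncatedSimplex H ε) : (hybridLearner G hε η c p₀).IsProper H := by
  intro o h hh
  rw [hybridLearner, PMF.support_map] at hh
  obtain ⟨k, -, rfl⟩ := hh
  exact k.2

theorem expectation_hybridLearner (hε : 0 < ε) (η c : ℝ) (p₀ : truncatedSimplex H ε)
    (o : List (Observation X)) {f : (X → Label) → ℝ} {B : ℝ} (hf : ∀ h, |f h| ≤ B) :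
    expectation (hybridLearner G hε η c p₀ o) f =
      ∑ k : H, (hybridWeights G hε η c p₀ o).1 k * f k.1 := by
  rw [hybridLearner, expectation_map _ _ hf, expectation_simplexPMF]
  rfl

theorem IsManipulationRule.hybridWeights_observe_cons (hz : IsManipulationRule G z) (hε : 0 < ε)
    (η c : ℝ) (p₀ : truncatedSimplex H ε) (o : List (Observation X)) (k : H) (a : Agent X) :
    hybridWeights G hε η c p₀ (Round.observe z ⟨k.1, a⟩ :: o) =
      if k ∈ rejectors G H a.1 then
        mirrorStep hε η c (hybridWeights G hε η c p₀ o)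
          (importanceWeightedGain (hybridWeights G hε η c p₀ o).1 (rejectors G H a.1)
            (-((a.2 : ℤ) : ℝ)))
      else hybridWeights G hε η c p₀ o := by
  by_cases hk : k ∈ rejectors G H a.1
  · rw [if_pos hk]
    refine (if_neg ((hz.mem_rejectors_iff k a.1).1 hk)).trans ?_
    simp only [Round.observe, hz.apply_eq_self_of_mem_rejectors hk]
  · rw [if_neg hk]
    exact if_pos (not_not.1 (mt (hz.mem_rejectors_iff k a.1).2 hk))

variable {η c : ℝ}

theorem expectation_nextRound_hybridLearner_le (hz : IsManipulationRule G z) (hε : 0 < ε)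
    (hη : 0 < η) (hc : 0 ≤ c) (hstable : 2 ≤ c ∨ η ≤ ε) (hn : Fintype.card H * ε ≤ 1)
    (p₀ : truncatedSimplex H ε) (h : H) (A : Adversary X) (past : List (Round X)) :
    expectation (nextRound z (hybridLearner G hε η c p₀) A past) (fun r =>
        strategicLoss z r.classifier r.agent - strategicLoss z h.1 r.agent +
          hybridPotential z G hε η c p₀ (truncatedVertex ε h) (r :: past)) ≤
      hybridPotential z G hε η c p₀ (truncatedVertex ε h) past +
        (η + Fintype.card H * ε) := by
  obtain ⟨B, hB⟩ := exists_abs_hybridDivergence_le hε η c (truncatedVertex_mem hε.le hn h)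
  have hbound : ∀ r : Round X,
      |strategicLoss z r.classifier r.agent - strategicLoss z h.1 r.agent +
        hybridPotential z G hε η c p₀ (truncatedVertex ε h) (r :: past)| ≤ 1 + B := fun r =>
    (abs_add_le _ _).trans (add_le_add (abs_strategicLoss_sub_le _ _ _) (hB _))
  rw [expectation_nextRound past hbound]
  refine expectation_le_of_forall_le (fun a => abs_expectation_le fun k => hbound ⟨k, a⟩)
    fun a => ?_
  have hlabel : |-((a.2 : ℤ) : ℝ)| ≤ 1 := by
    rcases Int.units_eq_one_or a.2 with hy | hy <;> simp [hy]
  rw [expectation_hybridLearner hε η c p₀ _ fun k => hbound ⟨k, a⟩]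
  simp only [hybridPotential, List.map_cons, hz.hybridWeights_observe_cons, hz.strategicLoss_eq,
    sub_sub_sub_cancel_left]
  exact expected_mirrorStep_le hε hη hc hstable hn _ (rejectors G H a.1) hlabel h

theorem expectedRegret_hybridLearner_le (hz : IsManipulationRule G z) (hH : H.Nonempty)
    (hε : 0 < ε) (hη : 0 < η) (hc : 0 ≤ c) (hstable : 2 ≤ c ∨ η ≤ ε)
    (hn : Fintype.card H * ε ≤ 1) (p₀ : truncatedSimplex H ε) {D : ℝ}
    (hD : ∀ u ∈ truncatedSimplex H ε, hybridDivergence η c u p₀.1 ≤ D) (A : Adversary X) (T : ℕ) :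
    expectedRegret z H hH (hybridLearner G hε η c p₀) A T ≤
      D + T * (η + Fintype.card H * ε) := by
  refine sup'_le _ _ fun h hh => ?_
  have hu := truncatedVertex_mem hε.le hn (⟨h, hh⟩ : H)
  obtain ⟨B, hB⟩ := exists_abs_hybridDivergence_le hε η c hu
  refine (sum_expectation_roundLaw_le
    (Φ := hybridPotential z G hε η c p₀ (truncatedVertex ε ⟨h, hh⟩))
    (fun r => abs_strategicLoss_sub_le _ _ _) (fun _ => hB _)
    (fun _ => hybridDivergence_nonneg hε hη.le hc hu (Subtype.property _))
    (expectation_nextRound_hybridLearner_le hz hε hη hc hstable hn p₀ ⟨h, hh⟩ A) T).trans ?_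
  exact add_le_add_left (hD _ hu) _

end HybridLearner

/-! ### Tuning the parameters -/

section Tuning

variable {X : Type*} {H : Finset (X → Label)} {T : ℕ}

theorem exists_learner_guaranteesRegret {ε η c : ℝ} (G : Digraph X) (hH : H.Nonempty) (hε : 0 < ε)
    (hη : 0 < η) (hc : 0 ≤ c) (hstable : 2 ≤ c ∨ η ≤ ε) (hn : #H * ε ≤ 1) (T : ℕ) :
    ∃ L : Learner X, L.IsProper H ∧ L.GuaranteesRegret G hH T
      (log #H / η + c * (#H * log (1 / ε)) + T * (η + #H * ε)) := by
  classical
  have : Nonempty H := hH.to_subtype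
  rw [← Fintype.card_coe H] at hn ⊢
  let p₀ : truncatedSimplex H ε := ⟨_, barycenter_mem_truncatedSimplex hn⟩
  refine ⟨hybridLearner G hε η c p₀, hybridLearner_isProper G hε η c p₀, fun z hz A => ?_⟩
  exact expectedRegret_hybridLearner_le hz hH hε hη hc hstable hn p₀
    (fun u hu => hybridDivergence_barycenter_le hε hη.le hc hu) A T

theorem exists_learner_guaranteesRegret_sqrt_add (G : Digraph X) (hH : H.Nonempty)
    (hcard : 2 ≤ #H) (hT : 1 ≤ T) :
    ∃ L : Learner X, L.IsProper H ∧
      L.GuaranteesRegret G hH T (3 * (√(T * log #H) + #H * log (#H * T))) := by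
  set n : ℝ := (#H : ℝ)
  have hn : (2 : ℝ) ≤ n := Nat.ofNat_le_cast.2 hcard
  have hT : (1 : ℝ) ≤ T := Nat.one_le_cast.2 hT
  have hlog : 0 < log n := log_pos (by linarith)
  set S := √(T * log n)
  have hS : 0 < S := sqrt_pos.2 (by positivity)
  have hSS : S * S = T * log n := mul_self_sqrt (by positivity)
  have hle : n * (1 / (n * T)) ≤ 1 := by
    rw [mul_one_div, div_le_one (by positivity)]
    exact le_mul_of_one_le_right (by linarith) hT
  obtain ⟨L, hproper, hL⟩ := exists_learner_guaranteesRegret (ε := 1 / (n * T)) (η := S / T) G hH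
    (by positivity) (by positivity) zero_le_two (Or.inl le_rfl) hle T
  refine ⟨L, hproper, hL.mono ?_⟩
  have hentropy : log n / (S / T) = S := by
    rw [div_div_eq_mul_div, mul_comm, ← hSS, mul_self_div_self]
  have hexploration : (T : ℝ) * (S / T + n * (1 / (n * T))) = S + 1 := by field_simp
  have hone : 1 ≤ n * log (n * T) := by
    have hlog2 : log 2 ≤ log (n * T) := log_le_log two_pos (by nlinarith)
    nlinarith [log_two_gt_d9]
  rw [hentropy, hexploration, one_div_one_div]
  linarith

theorem exists_learner_guaranteesRegret_sqrt_of_mul_log_le (G : Digraph X) (hH : H.Nonempty)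
    (hcard : 2 ≤ #H) (hT : #H * log #H ≤ T) :
    ∃ L : Learner X, L.IsProper H ∧ L.GuaranteesRegret G hH T (3 * √(T * #H * log #H)) := by
  set n : ℝ := (#H : ℝ)
  have hn : (2 : ℝ) ≤ n := Nat.ofNat_le_cast.2 hcard
  have hlog : 0 < log n := log_pos (by linarith)
  have hTpos : (0 : ℝ) < T := lt_of_lt_of_le (by positivity) hT
  set S := √(T * n * log n)
  have hS : 0 < S := sqrt_pos.2 (by positivity)
  have hSS : S * S = T * n * log n := mul_self_sqrt (by positivity)
  have hST : S ≤ T := sqrt_le_iff.2 ⟨hTpos.le, by nlinarith⟩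
  have hη : 0 < S / (n * T) := by positivity
  have hexploration : n * (S / (n * T)) = S / T := by field_simp
  obtain ⟨L, hproper, hL⟩ := exists_learner_guaranteesRegret G hH hη hη le_rfl (Or.inr le_rfl)
    (hexploration.trans_le (div_le_one_of_le₀ hST hTpos.le)) T
  refine ⟨L, hproper, hL.mono ?_⟩
  have hentropy : log n / (S / (n * T)) = S := by
    rw [div_div_eq_mul_div, mul_comm, mul_comm n, ← hSS, mul_self_div_self]
  have hvariance : (T : ℝ) * (S / (n * T) + S / T) = S / n + S := by field_simp
  rw [hentropy, hexploration, hvariance, zero_mul]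
  linarith [div_le_self hS.le (by linarith : 1 ≤ n)]

theorem exists_learner_guaranteesRegret_sqrt (G : Digraph X) (hH : H.Nonempty) (hcard : 2 ≤ #H)
    (T : ℕ) :
    ∃ L : Learner X, L.IsProper H ∧ L.GuaranteesRegret G hH T (3 * √(T * #H * log #H)) := by
  rcases le_total (#H * log #H) (T : ℝ) with hlong | hshort
  · exact exists_learner_guaranteesRegret_sqrt_of_mul_log_le G hH hcard hlong
  obtain ⟨L, hproper, hL⟩ := exists_learner_guaranteesRegret_horizon G hH T
  refine ⟨L, hproper, hL.mono ?_⟩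
  have htrivial : (T : ℝ) ≤ √(T * #H * log #H) := by
    refine le_sqrt_of_sq_le ?_
    rw [sq, mul_assoc]
    gcongr
  linarith [sqrt_nonneg ((T : ℝ) * #H * log #H)]

end Tuning

end StrategicOnline

theorem mainTheorem8 :
    ∃ C : ℝ, 0 < C ∧
      ∀ (X : Type*) (G : Digraph X) (H : Finset (X → StrategicOnline.Label)) (hH : H.Nonempty)
        (n T : ℕ), H.card = n → 1 ≤ T →
        ∃ L : StrategicOnline.Learner X, L.IsProper H ∧
          ∀ z : (X → StrategicOnline.Label) → X → X, StrategicOnline.IsManipulationRule G z →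
            ∀ A : StrategicOnline.Adversary X,
              StrategicOnline.expectedRegret z H hH L A T ≤
                C * min
                  (Real.sqrt ((T : ℝ) * Real.log (n : ℝ)) + (n : ℝ) * Real.log ((n : ℝ) * (T : ℝ)))
                  (Real.sqrt ((T : ℝ) * (n : ℝ) * Real.log (n : ℝ))) := by
  refine ⟨3, by norm_num, fun X G H hH n T hn hT => ?_⟩
  subst hn
  rcases (Nat.succ_le_of_lt hH.card_pos).eq_or_lt with hone | hcard
  · obtain ⟨L, hproper, hL⟩ :=
      StrategicOnline.exists_learner_guaranteesRegret_zero G hH hone.symm T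
    exact ⟨L, hproper, hL.mono (by simp [← hone, Real.log_natCast_nonneg])⟩
  rcases min_choice
      (Real.sqrt ((T : ℝ) * Real.log (H.card : ℝ)) + H.card * Real.log ((H.card : ℝ) * (T : ℝ)))
      (Real.sqrt ((T : ℝ) * (H.card : ℝ) * Real.log (H.card : ℝ))) with hmin | hmin <;> rw [hmin]
  · exact StrategicOnline.exists_learner_guaranteesRegret_sqrt_add G hH hcard hT
  · exact StrategicOnline.exists_learner_guaranteesRegret_sqrt G hH hcard T
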